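/- Let $\mathcal V$ be a closed, cocomplete, symmetric monoidal category with tensor product $\otimes$ and unit $\mathbb S$, and suppose that $\mathcal V$ is semi-additive (finite products and coproducts coincide naturally, so that its hom-sets are commutative monoids). An object $X$ of $\mathcal V$ is dualizable if there are an object $X^*$ and morphisms $\eta\colon\mathbb S\to X\otimes X^*$, $\epsilon\colon X^*\otimes X\to\mathbb S$ satisfying the two triangle identities; the trace $\operatorname{tr}(g)\colon\mathbb S\to\mathbb S$ of $g\colon X\to X$ is then the composite $$\mathbb S\xrightarrow{\eta}X\otimes X^*\xrightarrow{g\otimes\mathrm{id}}X\otimes X^*\cong X^*\otimes X\xrightarrow{\epsilon}\mathbb S .$$ Let $A$ be a finite category. For functors $\Phi\colon A^{\mathrm{op}}\to\mathcal V$ and $X\colon A\to\mathcal V$ put $\operatorname{colim}^\Phi(X)=\int^{a\in A}\Phi(a)\otimes X(a)$. The weight $\Phi$ is absolute if it is right dualizable as a $\mathcal V$-profunctor from the terminal category to $A$, that is, if there are a functor $Y\colon A\to\mathcal V$, a morphism $\eta\colon\mathbb S\to\int^{a}\Phi(a)\otimes Y(a)$, and morphisms $\epsilon_{a,b}\colon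 Y(b)\otimes\Phi(a)\to A(a,b)\cdot\mathbb S$ natural in $a$ and $b$ (where $A(a,b)\cdot\mathbb S$ denotes a coproduct of copies of $\mathbb S$), such that for every $a\in A$ the composites $$\Phi(a)\xrightarrow{\eta\otimes\mathrm{id}}\int^{b}\Phi(b)\otimes Y(b)\otimes\Phi(a)\xrightarrow{\mathrm{id}\otimes\epsilon}\int^{b}\Phi(b)\otimes\bigl(A(a,b)\cdot\mathbb S\bigr)\cong\Phi(a),$$ $$Y(a)\xrightarrow{\mathrm{id}\otimes\eta}\int^{b}Y(a)\otimes\Phi(b)\otimes Y(b)\xrightarrow{\epsilon\otimes\mathrm{id}}\int^{b}\bigl(A(b,a)\cdot\mathbb S\bigr)\otimes Y(b)\cong Y(a)$$ are identities. The trace of $\mathrm{id}_\Phi$ is the composite $$\mathbb S\xrightarrow{\eta}\int^{a}\Phi(a)\otimes Y(a)\cong\int^{a}Y(a)\otimes\Phi(a)\xrightarrow{\epsilon}\int^{a}A(a,a)\cdot\mathbb S\cong\bigoplus_{[\alpha]}\mathbb S ,$$ where $[\alpha]$ ranges over the conjugacy classes of endomorphisms in $A$, i.e. the classes of the equivalence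 relation on the disjoint union of the sets $A(a,a)$ generated by $\alpha\circ\beta\sim\beta\circ\alpha$ for all $\alpha\colon a\to b$ and $\beta\colon b\to a$. Let $\phi_{[\alpha]}\colon\mathbb S\to\mathbb S$ be the component of $\operatorname{tr}(\mathrm{id}_\Phi)$ at $[\alpha]$. Theorem. Let $\Phi\colon A^{\mathrm{op}}\to\mathcal V$ be absolute and let $X\colon A\to\mathcal V$ be a functor such that each $X(a)$ is dualizable. Then $\operatorname{colim}^\Phi(X)$ is dualizable, $$\operatorname{tr}\bigl(\mathrm{id}_{\operatorname{colim}^\Phi(X)}\bigr)=\sum_{[\alpha]}\phi_{[\alpha]}\cdot\operatorname{tr}(X_\alpha),$$ and, more generally, for every natural transformation $f\colon X\to X$, $$\operatorname{tr}\bigl(\operatorname{colim}^\Phi(f)\bigr)=\sum_{[\alpha]}\phi_{[\alpha]}\cdot\operatorname{tr}(f_a\circ X_\alpha).$$ Here $\alpha\colon a\to a$ is an arbitrary representative of its conjugacy class, and the product and the sum are the composition and the addition of $\mathcal V(\mathbb S,\mathbb S)$. -/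

import Mathlib

open CategoryTheory MonoidalCategory Limits Opposite

universe w v u

namespace WeightedColim

noncomputable section

section Monoidal

variable {V : Type u} [Category.{v} V] [MonoidalCategory V]

/-- The trace `𝟙 ⟶ X ⊗ X* ⟶ X ⊗ X* ≅ X* ⊗ X ⟶ 𝟙` of an endomorphism `f` of a dualizable object `X`.
`HasRightDual X` is a choice of `X*` together with a coevaluation `𝟙 ⟶ X ⊗ X*` and an evaluation
`X* ⊗ X ⟶ 𝟙` satisfying the two triangle identities. -/
def trace [SymmetricCategory V] {X : V} [HasRightDual X] (f : X ⟶ X) : 𝟙_ V ⟶ 𝟙_ V :=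
  η_ X Xᘁ ≫ f ▷ Xᘁ ≫ (β_ X Xᘁ).hom ≫ ε_ X Xᘁ

variable {A : Type w} [SmallCategory A]

/-- The bifunctor `(a, a') ↦ Φ a ⊗ X a'`. -/
@[simps]
def tensorDiagram (Φ : Aᵒᵖ ⥤ V) (X : A ⥤ V) : Aᵒᵖ ⥤ A ⥤ V where
  obj a :=
    { obj := fun a' => Φ.obj a ⊗ X.obj a'
      map := fun f => Φ.obj a ◁ X.map f }
  map f := { app := fun a' => Φ.map f ▷ X.obj a'
             naturality := fun _ _ g => (whisker_exchange (Φ.map f) (X.map g)) }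

/-- The bifunctor `(a, a') ↦ Y a' ⊗ Φ a`, that is, the composite profunctor `Y ⊙ Φ : A ⇸ A` of
`Y : A ⇸ 1` and `Φ : 1 ⇸ A`. -/
@[simps]
def outerDiagram (Y : A ⥤ V) (Φ : Aᵒᵖ ⥤ V) : Aᵒᵖ ⥤ A ⥤ V where
  obj a :=
    { obj := fun a' => Y.obj a' ⊗ Φ.obj a
      map := fun f => Y.map f ▷ Φ.obj a }
  map f := { app := fun a' => Y.obj a' ◁ Φ.map f
             naturality := fun _ _ g => (whisker_exchange (Y.map g) (Φ.map f)).symm }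

/-- The natural transformation `Φ a ⊗ X a' ⟶ Φ a ⊗ X' a'` induced by `f : X ⟶ X'`. -/
@[simps]
def tensorDiagramMap (Φ : Aᵒᵖ ⥤ V) {X X' : A ⥤ V} (f : X ⟶ X') :
    tensorDiagram Φ X ⟶ tensorDiagram Φ X' where
  app a := { app := fun a' => Φ.obj a ◁ f.app a'
             naturality := fun _ _ g => by
               change Φ.obj a ◁ X.map g ≫ Φ.obj a ◁ f.app _ = Φ.obj a ◁ f.app _ ≫ Φ.obj a ◁ X'.map g
               rw [← MonoidalCategory.whiskerLeft_comp, ← MonoidalCategory.whiskerLeft_comp,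
                 f.naturality] }
  naturality _ _ g := by
    ext a'
    exact (whisker_exchange (Φ.map g) (f.app a')).symm

/-- The symmetry `Φ a ⊗ Y a' ⟶ Y a' ⊗ Φ a`, natural in both variables. -/
@[simps]
def tensorDiagramSwap [SymmetricCategory V] (Φ : Aᵒᵖ ⥤ V) (Y : A ⥤ V) :
    tensorDiagram Φ Y ⟶ outerDiagram Y Φ where
  app a := { app := fun a' => (β_ (Φ.obj a) (Y.obj a')).hom
             naturality := fun _ _ g => BraidedCategory.braiding_naturality_right _ _ }
  naturality _ _ g := by
    ext a'
    exact BraidedCategory.braiding_naturality_left (Φ.map g) (Y.obj a')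

variable [HasColimitsOfSize.{w, w} V]

/-- The `Φ`-weighted colimit `∫^a Φ a ⊗ X a` of `X`. -/
abbrev wcolim (Φ : Aᵒᵖ ⥤ V) (X : A ⥤ V) : V := coend (tensorDiagram Φ X)

/-- The coprojection `Φ a ⊗ X a ⟶ ∫^a Φ a ⊗ X a`. -/
def wcolimι (Φ : Aᵒᵖ ⥤ V) (X : A ⥤ V) (a : A) : Φ.obj (op a) ⊗ X.obj a ⟶ wcolim Φ X :=
  coend.ι (tensorDiagram Φ X) a

/-- The morphism out of `∫^a Φ a ⊗ X a` with given components. -/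
def wcolimDesc (Φ : Aᵒᵖ ⥤ V) (X : A ⥤ V) {W : V} (g : ∀ a : A, Φ.obj (op a) ⊗ X.obj a ⟶ W)
    (hg : ∀ ⦃a b : A⦄ (f : a ⟶ b),
      Φ.map f.op ▷ X.obj a ≫ g a = Φ.obj (op b) ◁ X.map f ≫ g b) : wcolim Φ X ⟶ W :=
  coend.desc (F := tensorDiagram Φ X) g hg

lemma wcolimι_desc (Φ : Aᵒᵖ ⥤ V) (X : A ⥤ V) {W : V} (g : ∀ a : A, Φ.obj (op a) ⊗ X.obj a ⟶ W)
    (hg : ∀ ⦃a b : A⦄ (f : a ⟶ b),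
      Φ.map f.op ▷ X.obj a ≫ g a = Φ.obj (op b) ◁ X.map f ≫ g b) (a : A) :
    wcolimι Φ X a ≫ wcolimDesc Φ X g hg = g a :=
  coend.ι_desc (F := tensorDiagram Φ X) g hg a

/-- The morphism of weighted colimits induced by a natural transformation. -/
def wcolimMap (Φ : Aᵒᵖ ⥤ V) {X X' : A ⥤ V} (f : X ⟶ X') : wcolim Φ X ⟶ wcolim Φ X' :=
  coend.map (tensorDiagramMap Φ f)

variable (V A) in
/-- The unit profunctor `A ⇸ A`: the bifunctor sending `(a, a')` to the copower `A(a, a') · 𝟙`. -/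
def unitProf : Aᵒᵖ ⥤ A ⥤ V :=
  coyoneda ⋙ (Functor.whiskeringRight A (Type w) V).obj (sigmaConst.obj (𝟙_ V))

/-- The coprojection `𝟙 ⟶ A(a, a') · 𝟙` at `α : a ⟶ a'`. -/
def unitProfι {a a' : A} (α : a ⟶ a') : 𝟙_ V ⟶ ((unitProf V A).obj (op a)).obj a' :=
  Sigma.ι (fun _ : (a ⟶ a') => 𝟙_ V) α

/-- The morphism out of `A(a, a') · 𝟙` with given components. -/
def unitProfDesc {a a' : A} {W : V} (g : (a ⟶ a') → (𝟙_ V ⟶ W)) :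
    ((unitProf V A).obj (op a)).obj a' ⟶ W :=
  Sigma.desc (f := fun _ : (a ⟶ a') => 𝟙_ V) g

lemma unitProfι_desc {a a' : A} {W : V} (g : (a ⟶ a') → (𝟙_ V ⟶ W)) (α : a ⟶ a') :
    unitProfι α ≫ unitProfDesc g = g α := by
  exact Sigma.ι_desc (f := fun _ : (a ⟶ a') => 𝟙_ V) g α

lemma unitProf_hom_ext {a a' : A} {W : V} {g h : ((unitProf V A).obj (op a)).obj a' ⟶ W}
    (H : ∀ α : a ⟶ a', unitProfι α ≫ g = unitProfι α ≫ h) : g = h :=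
  Sigma.hom_ext (f := fun _ : (a ⟶ a') => 𝟙_ V) _ _ H

lemma unitProfι_map {a a' a'' : A} (α : a ⟶ a') (f : a' ⟶ a'') :
    unitProfι (V := V) α ≫ ((unitProf V A).obj (op a)).map f = unitProfι (α ≫ f) := by
  simp [unitProfι, unitProf, sigmaConst]

lemma unitProfι_map_app {a a' b : A} (α : a ⟶ a') (f : b ⟶ a) :
    unitProfι (V := V) α ≫ ((unitProf V A).map f.op).app a' = unitProfι (f ≫ α) := by
  simp [unitProfι, unitProf, sigmaConst]

variable (V A) in
/-- The shadow `∫^a A(a, a) · 𝟙` of the unit profunctor of `A`. -/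
abbrev shadow : V := coend (unitProf V A)

end Monoidal

section Closed

variable {V : Type u} [Category.{v} V] [MonoidalCategory V] [SymmetricCategory V]
  [MonoidalClosed V] [HasColimitsOfSize.{w, w} V] {A : Type w} [SmallCategory A]

lemma tensorUnitProf_hom_ext {a a' : A} {Z W : V}
    {g h : Z ⊗ ((unitProf V A).obj (op a)).obj a' ⟶ W}
    (H : ∀ α : a ⟶ a', Z ◁ unitProfι α ≫ g = Z ◁ unitProfι α ≫ h) : g = h := by
  apply MonoidalClosed.curry_injective
  refine unitProf_hom_ext fun α => ?_
  rw [← MonoidalClosed.curry_natural_left, ← MonoidalClosed.curry_natural_left, H]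

lemma unitProfTensor_hom_ext {a a' : A} {Z W : V}
    {g h : ((unitProf V A).obj (op a)).obj a' ⊗ Z ⟶ W}
    (H : ∀ α : a ⟶ a', unitProfι α ▷ Z ≫ g = unitProfι α ▷ Z ≫ h) : g = h := by
  rw [← cancel_epi (β_ Z (((unitProf V A).obj (op a)).obj a')).hom]
  refine tensorUnitProf_hom_ext fun α => ?_
  rw [BraidedCategory.braiding_naturality_right_assoc,
    BraidedCategory.braiding_naturality_right_assoc, H]

/-- The action `Φ b ⊗ (A(a, b) · 𝟙) ⟶ Φ a` of the arrows of `A` on a presheaf: it is `Φ α` on the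
copy of `Φ b` at `α : a ⟶ b`. -/
def presheafAct (Φ : Aᵒᵖ ⥤ V) (a b : A) :
    Φ.obj (op b) ⊗ ((unitProf V A).obj (op a)).obj b ⟶ Φ.obj (op a) :=
  MonoidalClosed.uncurry
    (unitProfDesc fun α => MonoidalClosed.curry ((ρ_ (Φ.obj (op b))).hom ≫ Φ.map α.op))

lemma unitProfι_presheafAct (Φ : Aᵒᵖ ⥤ V) {a b : A} (α : a ⟶ b) :
    Φ.obj (op b) ◁ unitProfι α ≫ presheafAct Φ a b = (ρ_ (Φ.obj (op b))).hom ≫ Φ.map α.op := by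
  rw [presheafAct, ← MonoidalClosed.uncurry_natural_left, unitProfι_desc,
    MonoidalClosed.uncurry_curry]

/-- The action `(A(b, a) · 𝟙) ⊗ Y b ⟶ Y a` of the arrows of `A` on a functor: it is `Y α` on the
copy of `Y b` at `α : b ⟶ a`. -/
def functorAct (Y : A ⥤ V) (b a : A) :
    ((unitProf V A).obj (op b)).obj a ⊗ Y.obj b ⟶ Y.obj a :=
  (β_ _ _).hom ≫ MonoidalClosed.uncurry
    (unitProfDesc fun α => MonoidalClosed.curry ((ρ_ (Y.obj b)).hom ≫ Y.map α))

lemma unitProfι_functorAct (Y : A ⥤ V) {b a : A} (α : b ⟶ a) :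
    unitProfι α ▷ Y.obj b ≫ functorAct Y b a = (λ_ (Y.obj b)).hom ≫ Y.map α := by
  rw [functorAct, BraidedCategory.braiding_naturality_left_assoc,
    ← MonoidalClosed.uncurry_natural_left, unitProfι_desc, MonoidalClosed.uncurry_curry,
    braiding_rightUnitor_assoc]

lemma presheafAct_dinatural (Φ : Aᵒᵖ ⥤ V) (a : A) {b b' : A} (f : b ⟶ b') :
    Φ.map f.op ▷ _ ≫ presheafAct Φ a b =
      Φ.obj (op b') ◁ ((unitProf V A).obj (op a)).map f ≫ presheafAct Φ a b' := by
  refine tensorUnitProf_hom_ext fun α => ?_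
  rw [whisker_exchange_assoc, unitProfι_presheafAct, ← MonoidalCategory.whiskerLeft_comp_assoc,
    unitProfι_map, unitProfι_presheafAct, rightUnitor_naturality_assoc, op_comp, Φ.map_comp]

lemma functorAct_dinatural (Y : A ⥤ V) (a : A) {b b' : A} (f : b ⟶ b') :
    ((unitProf V A).map f.op).app a ▷ Y.obj b ≫ functorAct Y b a =
      _ ◁ Y.map f ≫ functorAct Y b' a := by
  refine unitProfTensor_hom_ext fun α => ?_
  rw [← whisker_exchange_assoc, unitProfι_functorAct, ← comp_whiskerRight_assoc,
    unitProfι_map_app, unitProfι_functorAct, leftUnitor_naturality_assoc, Y.map_comp]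

/-- The component `Y b ⊗ Φ a ⟶ A(a, b) · 𝟙` of a morphism of profunctors `ε : Y ⊙ Φ ⟶ 𝕀_A`. -/
def evApp {Φ : Aᵒᵖ ⥤ V} {Y : A ⥤ V} (ε : outerDiagram Y Φ ⟶ unitProf V A) (a b : A) :
    Y.obj b ⊗ Φ.obj (op a) ⟶ ((unitProf V A).obj (op a)).obj b :=
  (ε.app (op a)).app b

lemma evApp_naturality {Φ : Aᵒᵖ ⥤ V} {Y : A ⥤ V} (ε : outerDiagram Y Φ ⟶ unitProf V A)
    (a : A) {b b' : A} (f : b ⟶ b') :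
    Y.map f ▷ Φ.obj (op a) ≫ evApp ε a b' = evApp ε a b ≫ ((unitProf V A).obj (op a)).map f :=
  (ε.app (op a)).naturality f

lemma evApp_naturality_op {Φ : Aᵒᵖ ⥤ V} {Y : A ⥤ V} (ε : outerDiagram Y Φ ⟶ unitProf V A)
    (a : A) {b b' : A} (f : b ⟶ b') :
    Y.obj a ◁ Φ.map f.op ≫ evApp ε b a = evApp ε b' a ≫ ((unitProf V A).map f.op).app a :=
  congrArg (fun t => t.app a) (ε.naturality f.op)

/-- The composite `(Φ ⊙ Y) ⊙ Φ ≅ Φ ⊙ (Y ⊙ Φ) ⟶ Φ ⊙ 𝕀_A ≅ Φ` at `a`, whose middle arrow is induced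
by `ε : Y ⊙ Φ ⟶ 𝕀_A`. On the summand at `b` it is
`(Φ b ⊗ Y b) ⊗ Φ a ≅ Φ b ⊗ (Y b ⊗ Φ a) ⟶ Φ b ⊗ (A(a, b) · 𝟙) ⟶ Φ a`; it is defined through
the internal hom because `- ⊗ Φ a` preserves the coend. -/
def contractLeft {Φ : Aᵒᵖ ⥤ V} {Y : A ⥤ V} (ε : outerDiagram Y Φ ⟶ unitProf V A) (a : A) :
    wcolim Φ Y ⊗ Φ.obj (op a) ⟶ Φ.obj (op a) :=
  (β_ _ _).hom ≫ MonoidalClosed.uncurry (wcolimDesc Φ Y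
    (fun b => MonoidalClosed.curry ((β_ (Φ.obj (op a)) (Φ.obj (op b) ⊗ Y.obj b)).hom ≫
      (α_ _ _ _).hom ≫ Φ.obj (op b) ◁ evApp ε a b ≫ presheafAct Φ a b))
    (fun b b' f => by
      rw [← MonoidalClosed.curry_natural_left, ← MonoidalClosed.curry_natural_left,
        BraidedCategory.braiding_naturality_right_assoc,
        BraidedCategory.braiding_naturality_right_assoc,
        associator_naturality_left_assoc, associator_naturality_middle_assoc,
        ← whisker_exchange_assoc, presheafAct_dinatural,
        ← MonoidalCategory.whiskerLeft_comp_assoc, ← MonoidalCategory.whiskerLeft_comp_assoc,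
        evApp_naturality]))

lemma wcolimι_contractLeft {Φ : Aᵒᵖ ⥤ V} {Y : A ⥤ V} (ε : outerDiagram Y Φ ⟶ unitProf V A)
    (a b : A) :
    wcolimι Φ Y b ▷ Φ.obj (op a) ≫ contractLeft ε a =
      (α_ _ _ _).hom ≫ Φ.obj (op b) ◁ evApp ε a b ≫ presheafAct Φ a b := by
  rw [contractLeft, BraidedCategory.braiding_naturality_left_assoc,
    ← MonoidalClosed.uncurry_natural_left, wcolimι_desc, MonoidalClosed.uncurry_curry,
    SymmetricCategory.symmetry_assoc]

/-- The composite `Y ⊙ (Φ ⊙ Y) ≅ (Y ⊙ Φ) ⊙ Y ⟶ 𝕀_A ⊙ Y ≅ Y` at `a`, whose middle arrow is induced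
by `ε : Y ⊙ Φ ⟶ 𝕀_A`. On the summand at `b` it is
`Y a ⊗ (Φ b ⊗ Y b) ≅ (Y a ⊗ Φ b) ⊗ Y b ⟶ (A(b, a) · 𝟙) ⊗ Y b ⟶ Y a`. -/
def contractRight {Φ : Aᵒᵖ ⥤ V} {Y : A ⥤ V} (ε : outerDiagram Y Φ ⟶ unitProf V A) (a : A) :
    Y.obj a ⊗ wcolim Φ Y ⟶ Y.obj a :=
  MonoidalClosed.uncurry (wcolimDesc Φ Y
    (fun b => MonoidalClosed.curry ((α_ (Y.obj a) (Φ.obj (op b)) (Y.obj b)).inv ≫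
      evApp ε b a ▷ Y.obj b ≫ functorAct Y b a))
    (fun b b' f => by
      rw [← MonoidalClosed.curry_natural_left, ← MonoidalClosed.curry_natural_left,
        associator_inv_naturality_middle_assoc, associator_inv_naturality_right_assoc,
        whisker_exchange_assoc, ← functorAct_dinatural,
        ← comp_whiskerRight_assoc, ← comp_whiskerRight_assoc, evApp_naturality_op]))

lemma wcolimι_contractRight {Φ : Aᵒᵖ ⥤ V} {Y : A ⥤ V} (ε : outerDiagram Y Φ ⟶ unitProf V A)
    (a b : A) :
    Y.obj a ◁ wcolimι Φ Y b ≫ contractRight ε a =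
      (α_ _ _ _).inv ≫ evApp ε b a ▷ Y.obj b ≫ functorAct Y b a := by
  rw [contractRight, ← MonoidalClosed.uncurry_natural_left, wcolimι_desc,
    MonoidalClosed.uncurry_curry]

/-- A right dual of a weight `Φ : Aᵒᵖ ⥤ V`, regarded as a profunctor `1 ⇸ A`: a profunctor
`Y : A ⇸ 1` with a coevaluation `η : 𝟙 ⟶ Φ ⊙ Y` and an evaluation `ε : Y ⊙ Φ ⟶ 𝕀_A` satisfying
both triangle identities. -/
structure RightDual (Φ : Aᵒᵖ ⥤ V) where
  dual : A ⥤ V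
  coev : 𝟙_ V ⟶ wcolim Φ dual
  ev : outerDiagram dual Φ ⟶ unitProf V A
  triangle_left (a : A) :
    coev ▷ Φ.obj (op a) ≫ contractLeft ev a = (λ_ (Φ.obj (op a))).hom
  triangle_right (a : A) :
    dual.obj a ◁ coev ≫ contractRight ev a = (ρ_ (dual.obj a)).hom

/-- A weight is absolute if it is right dualizable as a profunctor `1 ⇸ A`. -/
def IsAbsolute (Φ : Aᵒᵖ ⥤ V) : Prop := Nonempty (RightDual Φ)

/-- The coefficient vector of `Φ`: the trace of `𝟙 Φ`, that is, the composite
`𝟙 ⟶ ⟪Φ ⊙ Y⟫ ≅ ⟪Y ⊙ Φ⟫ ⟶ ⟪𝕀_A⟫` of the coevaluation, the symmetry and the evaluation. -/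
def coeffVector {Φ : Aᵒᵖ ⥤ V} (D : RightDual Φ) : 𝟙_ V ⟶ shadow V A :=
  D.coev ≫ coend.map (tensorDiagramSwap Φ D.dual) ≫ coend.map D.ev

end Closed

section Conjugacy

variable (A : Type w) [SmallCategory A]

/-- The endomorphisms of `A`, each with its object. -/
abbrev Endo : Type w := Σ a : A, (a ⟶ a)

/-- The relation `β ∘ α ∼ α ∘ β` for `α : a ⟶ b` and `β : b ⟶ a`. -/
inductive Endo.Rel : Endo A → Endo A → Prop
  | swap {a b : A} (α : a ⟶ b) (β : b ⟶ a) : Endo.Rel ⟨a, α ≫ β⟩ ⟨b, β ≫ α⟩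

/-- The conjugacy classes of endomorphisms in `A`: the quotient by the equivalence relation
generated by `Endo.Rel`. -/
def ConjClass : Type w := Quot (Endo.Rel A)

variable {A} in
/-- The conjugacy class of an endomorphism. -/
def ConjClass.mk {a : A} (α : a ⟶ a) : ConjClass A := Quot.mk _ ⟨a, α⟩

variable {A} in
lemma ConjClass.mk_swap {a b : A} (α : a ⟶ b) (β : b ⟶ a) :
    ConjClass.mk (α ≫ β) = ConjClass.mk (β ≫ α) :=
  Quot.sound (Endo.Rel.swap α β)

instance [FinCategory A] : Finite (ConjClass A) :=
  inferInstanceAs (Finite (Quot (Endo.Rel A)))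

instance [FinCategory A] : Fintype (ConjClass A) := Fintype.ofFinite _

end Conjugacy

section Semiadditive

variable {V : Type u} [Category.{v} V] [MonoidalCategory V] [HasColimitsOfSize.{w, w} V]
  {A : Type w} [SmallCategory A]

/-- The coprojection `𝟙 ⟶ ⟪𝕀_A⟫` at an endomorphism `α`. -/
def shadowι {a : A} (α : a ⟶ a) : 𝟙_ V ⟶ shadow V A :=
  unitProfι α ≫ coend.ι (unitProf V A) a

open Classical in
/-- The projection of `⟪𝕀_A⟫`, a sum of copies of `𝟙` indexed by the conjugacy classes of `A`, onto
the copy at the class `c`. -/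
def shadowProj [HasZeroMorphisms V] (c : ConjClass A) : shadow V A ⟶ 𝟙_ V :=
  coend.desc (fun _ => unitProfDesc fun α => if ConjClass.mk α = c then 𝟙 (𝟙_ V) else 0)
    (fun a b f => unitProf_hom_ext fun β => by
      erw [reassoc_of% unitProfι_map_app (V := V) β f, reassoc_of% unitProfι_map (V := V) β f]
      rw [unitProfι_desc, unitProfι_desc, ConjClass.mk_swap])

open Classical in
lemma shadowι_proj [HasZeroMorphisms V] {a : A} (α : a ⟶ a) (c : ConjClass A) :
    shadowι α ≫ shadowProj c = if ConjClass.mk α = c then 𝟙 (𝟙_ V) else 0 := by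
  rw [shadowι, shadowProj, Category.assoc]
  erw [coend.ι_desc]
  exact unitProfι_desc _ α

/-- The coefficient `φ_c` of an absolute weight: the entry of its coefficient vector at `c`. -/
def coeff [SymmetricCategory V] [MonoidalClosed V] [HasZeroMorphisms V] {Φ : Aᵒᵖ ⥤ V}
    (D : RightDual Φ) (c : ConjClass A) : 𝟙_ V ⟶ 𝟙_ V :=
  coeffVector D ≫ shadowProj c

end Semiadditive

end

end WeightedColim

open WeightedColim

/- The addition on the hom-sets of a semi-additive category: `f + g` is the composite
`X ⟶ X ⊞ X ⟶ Y` of the diagonal and `(f, g)`. -/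
attribute [local instance] hasBinaryBiproducts_of_finite_biproducts
attribute [local instance]
  SemiadditiveOfBinaryBiproducts.addCommMonoidHomOfHasBinaryBiproducts

/-! A right dual `Y` of `Φ` makes `Y ⊗ -` left adjoint to `colim^Φ`, with counit
`Y b ⊗ colim^Φ X ⟶ X b`. For a pointwise dualizable `X`, the dual of `colim^Φ X` is
`∫^a (X a)* ⊗ Y a`: its evaluation is the transpose of the counit, and its coevaluation is the
unit `𝟙 ⟶ colim^Φ Y` followed by `colim^Φ` of the transformation `Y a ⟶ X a ⊗ ∫^b (X b)* ⊗ Y b`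
that inserts the coevaluation of `X a`. Rotating the resulting trace cyclically turns it into the
coefficient vector `𝟙 ⟶ ⟪𝕀_A⟫` of `Φ` followed by the morphism `⟪𝕀_A⟫ ⟶ 𝟙` whose component at `α`
is the trace of `f a ∘ X α`. In the semi-additive case `⟪𝕀_A⟫` is the biproduct of copies of `𝟙`
over the conjugacy classes, and the composite is the sum of the products of entries. -/

namespace WeightedColim

noncomputable section

section Trace

variable {V : Type u} [Category.{v} V] [MonoidalCategory V] [SymmetricCategory V]

lemma trace_comm {X Y : V} [HasRightDual X] [HasRightDual Y] (f : X ⟶ Y) (g : Y ⟶ X) :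
    trace (f ≫ g) = trace (g ≫ f) := by
  simp only [trace, comp_whiskerRight, Category.assoc]
  rw [← coevaluation_comp_rightAdjointMate_assoc, whisker_exchange_assoc,
    BraidedCategory.braiding_naturality_right_assoc, rightAdjointMate_comp_evaluation,
    BraidedCategory.braiding_naturality_left_assoc, BraidedCategory.braiding_naturality_left_assoc,
    BraidedCategory.braiding_naturality_left_assoc]

lemma trace_eq_of_exactPairing {X : V} (Z : V) [ExactPairing X Z] [HasRightDual X] (f : X ⟶ X) :
    trace f = η_ X Z ≫ f ▷ Z ≫ (β_ X Z).hom ≫ ε_ X Z := by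
  have h := @trace_comm V _ _ _ X X _ ⟨Z⟩ f (𝟙 X)
  rwa [Category.comp_id, Category.id_comp] at h

/-- The partial trace `U ⟶ X ⊗ X* ⊗ U ⟶ X* ⊗ U ⊗ X ⟶ X* ⊗ X ⟶ 𝟙` over `X` of a morphism
`h : U ⊗ X ⟶ X`, which specializes to `trace` for `U = 𝟙`. -/
def partialTrace {U X : V} [HasRightDual X] (h : U ⊗ X ⟶ X) : U ⟶ 𝟙_ V :=
  (λ_ U).inv ≫ η_ X Xᘁ ▷ U ≫ (α_ X Xᘁ U).hom ≫ (β_ X (Xᘁ ⊗ U)).hom ≫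
    (α_ Xᘁ U X).hom ≫ Xᘁ ◁ h ≫ ε_ X Xᘁ

lemma comp_partialTrace {U U' X : V} [HasRightDual X] (t : U' ⟶ U) (h : U ⊗ X ⟶ X) :
    t ≫ partialTrace h = partialTrace (t ▷ X ≫ h) := by
  rw [partialTrace, partialTrace, leftUnitor_inv_naturality_assoc, whisker_exchange_assoc,
    associator_naturality_right_assoc, BraidedCategory.braiding_naturality_right_assoc,
    associator_naturality_middle_assoc, MonoidalCategory.whiskerLeft_comp_assoc]

lemma partialTrace_leftUnitor_comp {X : V} [HasRightDual X] (g : X ⟶ X) :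
    partialTrace ((λ_ X).hom ≫ g) = trace g := by
  have braiding_unit : (β_ X (Xᘁ ⊗ 𝟙_ V)).hom ≫ (α_ Xᘁ (𝟙_ V) X).hom ≫ (Xᘁ : V) ◁ (λ_ X).hom =
      X ◁ (ρ_ Xᘁ).hom ≫ (β_ X Xᘁ).hom := by
    rw [MonoidalCategory.triangle, BraidedCategory.braiding_naturality_right]
  rw [partialTrace, MonoidalCategory.whiskerLeft_comp_assoc, reassoc_of% braiding_unit, trace,
    BraidedCategory.braiding_naturality_left_assoc]
  have coherence : (λ_ (𝟙_ V)).inv ≫ η_ X Xᘁ ▷ 𝟙_ V ≫ (α_ X Xᘁ (𝟙_ V)).hom ≫ X ◁ (ρ_ Xᘁ).hom =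
      η_ X Xᘁ := by
    monoidal
  rw [reassoc_of% coherence]

lemma braiding_rotate (P X W : V) :
    (β_ P (X ⊗ W)).hom ≫ (α_ X W P).hom ≫ (β_ X (W ⊗ P)).hom =
      (α_ P X W).inv ≫ (β_ (P ⊗ X) W).hom ≫ (α_ W P X).inv := by
  have swap : (β_ X (W ⊗ P)).hom = X ◁ (β_ W P).hom ≫ (β_ X (P ⊗ W)).hom ≫ (β_ P W).hom ▷ X := by
    rw [BraidedCategory.braiding_naturality_right_assoc, ← comp_whiskerRight,
      SymmetricCategory.symmetry, id_whiskerRight, Category.comp_id]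
  rw [swap]
  simp only [BraidedCategory.braiding_tensor_right_hom, BraidedCategory.braiding_tensor_left_hom,
    Category.assoc, Iso.inv_hom_id_assoc, Iso.hom_inv_id_assoc, Iso.hom_inv_id, Category.comp_id,
    ← MonoidalCategory.whiskerLeft_comp_assoc, ← comp_whiskerRight_assoc,
    SymmetricCategory.symmetry, MonoidalCategory.whiskerLeft_id, id_whiskerRight,
    Category.id_comp]

lemma braiding_comp_partialTrace {P Q X : V} [HasRightDual X] (k : Q ⊗ P ⊗ X ⟶ X) :
    (β_ P Q).hom ≫ partialTrace ((α_ Q P X).hom ≫ k) =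
      P ◁ ((λ_ Q).inv ≫ η_ X Xᘁ ▷ Q ≫ (α_ X Xᘁ Q).hom) ≫ (α_ P X (Xᘁ ⊗ Q)).inv ≫
        (β_ (P ⊗ X) (Xᘁ ⊗ Q)).hom ≫ (α_ Xᘁ Q (P ⊗ X)).hom ≫ Xᘁ ◁ k ≫ ε_ X Xᘁ := by
  have reassociate : (β_ X (Xᘁ ⊗ Q ⊗ P)).hom ≫ (α_ Xᘁ (Q ⊗ P) X).hom ≫
      (Xᘁ : V) ◁ (α_ Q P X).hom = X ◁ (α_ Xᘁ Q P).inv ≫ (β_ X ((Xᘁ ⊗ Q) ⊗ P)).hom ≫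
        (α_ (Xᘁ ⊗ Q) P X).hom ≫ (α_ Xᘁ Q (P ⊗ X)).hom := by
    rw [BraidedCategory.braiding_naturality_right_assoc, pentagon_inv_hom_hom_hom_hom]
  calc
    _ = (β_ P Q).hom ≫ ((λ_ Q).inv ≫ η_ X Xᘁ ▷ Q ≫ (α_ X Xᘁ Q).hom) ▷ P ≫
        (α_ X (Xᘁ ⊗ Q) P).hom ≫ (β_ X ((Xᘁ ⊗ Q) ⊗ P)).hom ≫ (α_ (Xᘁ ⊗ Q) P X).hom ≫
          (α_ Xᘁ Q (P ⊗ X)).hom ≫ Xᘁ ◁ k ≫ ε_ X Xᘁ := by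
      rw [partialTrace, MonoidalCategory.whiskerLeft_comp_assoc, reassoc_of% reassociate]
      monoidal
    _ = P ◁ ((λ_ Q).inv ≫ η_ X Xᘁ ▷ Q ≫ (α_ X Xᘁ Q).hom) ≫ (β_ P (X ⊗ (Xᘁ ⊗ Q))).hom ≫
        (α_ X (Xᘁ ⊗ Q) P).hom ≫ (β_ X ((Xᘁ ⊗ Q) ⊗ P)).hom ≫ (α_ (Xᘁ ⊗ Q) P X).hom ≫
          (α_ Xᘁ Q (P ⊗ X)).hom ≫ Xᘁ ◁ k ≫ ε_ X Xᘁ := by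
      rw [BraidedCategory.braiding_naturality_right_assoc]
    _ = _ := by
      rw [reassoc_of% braiding_rotate P X (Xᘁ ⊗ Q), Iso.inv_hom_id_assoc]

end Trace

section Shadow

variable {V : Type u} [Category.{v} V] [MonoidalCategory V] [HasColimitsOfSize.{w, w} V]
  {A : Type w} [SmallCategory A]

lemma shadow_hom_ext {W : V} {g h : shadow V A ⟶ W}
    (H : ∀ ⦃a : A⦄ (α : a ⟶ a), shadowι α ≫ g = shadowι α ≫ h) : g = h :=
  coend.hom_ext fun a => unitProf_hom_ext fun α => by
    simpa only [shadowι, Category.assoc] using H α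

lemma shadowι_comp_comm {a b : A} (α : a ⟶ b) (β : b ⟶ a) :
    (shadowι (α ≫ β) : 𝟙_ V ⟶ shadow V A) = shadowι (β ≫ α) := by
  rw [shadowι, shadowι, ← unitProfι_map_app β α, ← unitProfι_map β α, Category.assoc,
    Category.assoc, coend.condition]

lemma shadowι_eq_of_mk_eq {x y : Endo A} (h : ConjClass.mk x.2 = ConjClass.mk y.2) :
    (shadowι x.2 : 𝟙_ V ⟶ shadow V A) = shadowι y.2 :=
  congrArg (Quot.lift (fun z : Endo A => (shadowι z.2 : 𝟙_ V ⟶ shadow V A)) <| by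
    rintro _ _ ⟨α, β⟩
    exact shadowι_comp_comm α β) h

/-- The morphism `⟪𝕀_A⟫ ⟶ 𝟙` whose component at `α : a ⟶ a` is the trace of `X α ≫ f a`. -/
def shadowTrace [SymmetricCategory V] (X : A ⥤ V) [∀ a, HasRightDual (X.obj a)] (f : X ⟶ X) :
    shadow V A ⟶ 𝟙_ V :=
  coend.desc (fun a => unitProfDesc fun α => trace (X.map α ≫ f.app a)) fun a b α =>
    unitProf_hom_ext fun β => by
      rw [reassoc_of% unitProfι_map_app (V := V) β α, reassoc_of% unitProfι_map (V := V) β α,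
        unitProfι_desc, unitProfι_desc, X.map_comp, Category.assoc, f.naturality, trace_comm,
        Category.assoc, f.naturality, X.map_comp]

lemma shadowι_shadowTrace [SymmetricCategory V] (X : A ⥤ V) [∀ a, HasRightDual (X.obj a)]
    (f : X ⟶ X) {a : A} (α : a ⟶ a) :
    shadowι α ≫ shadowTrace X f = trace (X.map α ≫ f.app a) := by
  rw [shadowι, Category.assoc]
  exact (congrArg (unitProfι α ≫ ·) (coend.ι_desc _ _ a)).trans (unitProfι_desc _ α)

end Shadow

section WeightedColimit

variable {V : Type u} [Category.{v} V] [MonoidalCategory V] [HasColimitsOfSize.{w, w} V]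
  {A : Type w} [SmallCategory A]

lemma wcolim_hom_ext {Φ : Aᵒᵖ ⥤ V} {X : A ⥤ V} {W : V} {g h : wcolim Φ X ⟶ W}
    (H : ∀ a, wcolimι Φ X a ≫ g = wcolimι Φ X a ≫ h) : g = h :=
  coend.hom_ext H

lemma wcolimι_condition (Φ : Aᵒᵖ ⥤ V) (X : A ⥤ V) {a b : A} (f : a ⟶ b) :
    Φ.map f.op ▷ X.obj a ≫ wcolimι Φ X a = Φ.obj (op b) ◁ X.map f ≫ wcolimι Φ X b :=
  coend.condition (tensorDiagram Φ X) f

lemma wcolimι_map (Φ : Aᵒᵖ ⥤ V) {X X' : A ⥤ V} (f : X ⟶ X') (a : A) :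
    wcolimι Φ X a ≫ wcolimMap Φ f = Φ.obj (op a) ◁ f.app a ≫ wcolimι Φ X' a :=
  coend.ι_map (tensorDiagramMap Φ f) a

lemma wcolimMap_id (Φ : Aᵒᵖ ⥤ V) (X : A ⥤ V) : wcolimMap Φ (𝟙 X) = 𝟙 (wcolim Φ X) :=
  wcolim_hom_ext fun a => by
    rw [wcolimι_map, NatTrans.id_app, MonoidalCategory.whiskerLeft_id, Category.id_comp,
      Category.comp_id]

/-- The comparison `∫^a Φ a ⊗ (X a ⊗ Z) ⟶ (∫^a Φ a ⊗ X a) ⊗ Z`. -/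
def wcolimTensorRight (Φ : Aᵒᵖ ⥤ V) (X : A ⥤ V) (Z : V) :
    wcolim Φ (X ⋙ tensorRight Z) ⟶ wcolim Φ X ⊗ Z :=
  wcolimDesc Φ _ (fun a => (α_ _ _ _).inv ≫ wcolimι Φ X a ▷ Z) fun a b f => by
    dsimp only [Functor.comp_obj, Functor.comp_map, Functor.flip_obj_obj, Functor.flip_obj_map,
      curriedTensor_obj_obj, curriedTensor_map_app]
    rw [associator_inv_naturality_left_assoc, associator_inv_naturality_middle_assoc,
      ← comp_whiskerRight, ← comp_whiskerRight, wcolimι_condition]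

lemma wcolimι_tensorRight (Φ : Aᵒᵖ ⥤ V) (X : A ⥤ V) (Z : V) (a : A) :
    wcolimι Φ (X ⋙ tensorRight Z) a ≫ wcolimTensorRight Φ X Z =
      (α_ _ _ _).inv ≫ wcolimι Φ X a ▷ Z :=
  wcolimι_desc _ _ _ _ a

lemma tensorWcolim_hom_ext [MonoidalClosed V] {Φ : Aᵒᵖ ⥤ V} {X : A ⥤ V} {Z W : V}
    {g h : Z ⊗ wcolim Φ X ⟶ W}
    (H : ∀ a, Z ◁ wcolimι Φ X a ≫ g = Z ◁ wcolimι Φ X a ≫ h) : g = h :=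
  MonoidalClosed.curry_injective <| wcolim_hom_ext fun a => by
    rw [← MonoidalClosed.curry_natural_left, ← MonoidalClosed.curry_natural_left, H]

variable [SymmetricCategory V] [MonoidalClosed V]

lemma wcolimTensor_hom_ext {Φ : Aᵒᵖ ⥤ V} {X : A ⥤ V} {Z W : V} {g h : wcolim Φ X ⊗ Z ⟶ W}
    (H : ∀ a, wcolimι Φ X a ▷ Z ≫ g = wcolimι Φ X a ▷ Z ≫ h) : g = h := by
  rw [← cancel_epi (β_ Z (wcolim Φ X)).hom]
  refine tensorWcolim_hom_ext fun a => ?_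
  rw [BraidedCategory.braiding_naturality_right_assoc,
    BraidedCategory.braiding_naturality_right_assoc, H]

/-- The morphism out of `(∫^a Φ a ⊗ X a) ⊗ Z` with given components. -/
def wcolimTensorDesc (Φ : Aᵒᵖ ⥤ V) (X : A ⥤ V) {Z W : V}
    (g : ∀ a, (Φ.obj (op a) ⊗ X.obj a) ⊗ Z ⟶ W)
    (hg : ∀ ⦃a b : A⦄ (f : a ⟶ b),
      Φ.map f.op ▷ X.obj a ▷ Z ≫ g a = (Φ.obj (op b) ◁ X.map f) ▷ Z ≫ g b) :
    wcolim Φ X ⊗ Z ⟶ W :=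
  (β_ _ _).hom ≫ MonoidalClosed.uncurry (wcolimDesc Φ X
    (fun a => MonoidalClosed.curry ((β_ _ _).hom ≫ g a)) fun a b f => by
      rw [← MonoidalClosed.curry_natural_left, ← MonoidalClosed.curry_natural_left,
        BraidedCategory.braiding_naturality_right_assoc,
        BraidedCategory.braiding_naturality_right_assoc, hg])

lemma wcolimι_tensorDesc (Φ : Aᵒᵖ ⥤ V) (X : A ⥤ V) {Z W : V}
    (g : ∀ a, (Φ.obj (op a) ⊗ X.obj a) ⊗ Z ⟶ W)
    (hg : ∀ ⦃a b : A⦄ (f : a ⟶ b),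
      Φ.map f.op ▷ X.obj a ▷ Z ≫ g a = (Φ.obj (op b) ◁ X.map f) ▷ Z ≫ g b) (a : A) :
    wcolimι Φ X a ▷ Z ≫ wcolimTensorDesc Φ X g hg = g a := by
  rw [wcolimTensorDesc, BraidedCategory.braiding_naturality_left_assoc,
    ← MonoidalClosed.uncurry_natural_left, wcolimι_desc, MonoidalClosed.uncurry_curry,
    SymmetricCategory.symmetry_assoc]

end WeightedColimit

section Evaluation

variable {V : Type u} [Category.{v} V] [MonoidalCategory V] [SymmetricCategory V]
  [MonoidalClosed V] [HasColimitsOfSize.{w, w} V] {A : Type w} [SmallCategory A]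

lemma functorAct_comp_map (X : A ⥤ V) (a : A) {b b' : A} (f : b ⟶ b') :
    functorAct X a b ≫ X.map f =
      ((unitProf V A).obj (op a)).map f ▷ X.obj a ≫ functorAct X a b' := by
  refine unitProfTensor_hom_ext fun α => ?_
  rw [reassoc_of% unitProfι_functorAct X α, ← comp_whiskerRight_assoc, unitProfι_map,
    unitProfι_functorAct, X.map_comp]

lemma functorAct_comp_app {X X' : A ⥤ V} (f : X ⟶ X') (a b : A) :
    functorAct X a b ≫ f.app b = _ ◁ f.app a ≫ functorAct X' a b := by
  refine unitProfTensor_hom_ext fun α => ?_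
  rw [reassoc_of% unitProfι_functorAct X α, ← whisker_exchange_assoc, unitProfι_functorAct,
    leftUnitor_naturality_assoc, f.naturality]

lemma functorAct_comp_tensorRight (X : A ⥤ V) (Z : V) (a b : A) :
    functorAct (X ⋙ tensorRight Z) a b = (α_ _ _ _).inv ≫ functorAct X a b ▷ Z := by
  refine unitProfTensor_hom_ext fun α => ?_
  rw [unitProfι_functorAct]
  dsimp only [Functor.comp_obj, Functor.comp_map, Functor.flip_obj_obj, Functor.flip_obj_map,
    curriedTensor_obj_obj, curriedTensor_map_app]
  rw [associator_inv_naturality_left_assoc, ← comp_whiskerRight, unitProfι_functorAct]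
  monoidal

lemma presheafAct_wcolimι (Φ : Aᵒᵖ ⥤ V) (X : A ⥤ V) (a b : A) :
    presheafAct Φ a b ▷ X.obj a ≫ wcolimι Φ X a =
      (α_ _ _ _).hom ≫ Φ.obj (op b) ◁ functorAct X a b ≫ wcolimι Φ X b := by
  rw [← cancel_epi (α_ _ _ _).inv, Iso.inv_hom_id_assoc]
  refine MonoidalClosed.curry_injective (unitProfTensor_hom_ext fun α => ?_)
  rw [← MonoidalClosed.curry_natural_left, ← MonoidalClosed.curry_natural_left]
  congr 1
  rw [associator_inv_naturality_middle_assoc, ← comp_whiskerRight_assoc, unitProfι_presheafAct,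
    ← MonoidalCategory.whiskerLeft_comp_assoc, unitProfι_functorAct, comp_whiskerRight,
    Category.assoc, wcolimι_condition, MonoidalCategory.whiskerLeft_comp, Category.assoc,
    triangle_assoc_comp_right_assoc]

variable {Φ : Aᵒᵖ ⥤ V} {Y : A ⥤ V} (ε : outerDiagram Y Φ ⟶ unitProf V A)

/-- The composite `Y b ⊗ ∫^a Φ a ⊗ X a ⟶ ∫^a (A(a, b) · 𝟙) ⊗ X a ≅ X b`, whose first arrow is
induced by `ε`. If `ε` is the evaluation of a right dual of `Φ`, this is the counit of the
adjunction between `Y ⊗ -` and `colim^Φ`. For `X = Y` it is `contractRight`. -/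
def wcolimEval (X : A ⥤ V) (b : A) : Y.obj b ⊗ wcolim Φ X ⟶ X.obj b :=
  MonoidalClosed.uncurry (wcolimDesc Φ X
    (fun a => MonoidalClosed.curry ((α_ (Y.obj b) (Φ.obj (op a)) (X.obj a)).inv ≫
      evApp ε a b ▷ X.obj a ≫ functorAct X a b))
    fun a a' f => by
      rw [← MonoidalClosed.curry_natural_left, ← MonoidalClosed.curry_natural_left,
        associator_inv_naturality_middle_assoc, associator_inv_naturality_right_assoc,
        whisker_exchange_assoc, ← functorAct_dinatural,
        ← comp_whiskerRight_assoc, ← comp_whiskerRight_assoc, evApp_naturality_op])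

lemma wcolimι_wcolimEval (X : A ⥤ V) (a b : A) :
    Y.obj b ◁ wcolimι Φ X a ≫ wcolimEval ε X b =
      (α_ _ _ _).inv ≫ evApp ε a b ▷ X.obj a ≫ functorAct X a b := by
  rw [wcolimEval, ← MonoidalClosed.uncurry_natural_left, wcolimι_desc,
    MonoidalClosed.uncurry_curry]

lemma wcolimEval_comp_map (X : A ⥤ V) {b b' : A} (f : b ⟶ b') :
    wcolimEval ε X b ≫ X.map f = Y.map f ▷ wcolim Φ X ≫ wcolimEval ε X b' := by
  refine tensorWcolim_hom_ext fun a => ?_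
  rw [reassoc_of% wcolimι_wcolimEval ε X a b, functorAct_comp_map, whisker_exchange_assoc,
    wcolimι_wcolimEval, associator_inv_naturality_left_assoc, ← comp_whiskerRight_assoc,
    ← comp_whiskerRight_assoc, evApp_naturality]

lemma wcolimEval_comp_app {X X' : A ⥤ V} (f : X ⟶ X') (b : A) :
    wcolimEval ε X b ≫ f.app b = Y.obj b ◁ wcolimMap Φ f ≫ wcolimEval ε X' b := by
  refine tensorWcolim_hom_ext fun a => ?_
  rw [reassoc_of% wcolimι_wcolimEval ε X a b, functorAct_comp_app,
    ← MonoidalCategory.whiskerLeft_comp_assoc, wcolimι_map,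
    MonoidalCategory.whiskerLeft_comp_assoc, wcolimι_wcolimEval,
    associator_inv_naturality_right_assoc, whisker_exchange_assoc]

lemma wcolimEval_comp_tensorRight (X : A ⥤ V) (Z : V) (b : A) :
    wcolimEval ε (X ⋙ tensorRight Z) b =
      Y.obj b ◁ wcolimTensorRight Φ X Z ≫ (α_ _ _ _).inv ≫ wcolimEval ε X b ▷ Z := by
  refine tensorWcolim_hom_ext fun a => ?_
  rw [wcolimι_wcolimEval, functorAct_comp_tensorRight, ← MonoidalCategory.whiskerLeft_comp_assoc,
    wcolimι_tensorRight, MonoidalCategory.whiskerLeft_comp_assoc,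
    associator_inv_naturality_middle_assoc, ← comp_whiskerRight, wcolimι_wcolimEval]
  dsimp only [Functor.comp_obj, Functor.flip_obj_obj, curriedTensor_obj_obj]
  monoidal

end Evaluation

section Duality

variable {V : Type u} [Category.{v} V] [MonoidalCategory V] {A : Type w} [SmallCategory A]

/-- The presheaf `a ↦ (X a)*` of right duals of a pointwise dualizable functor. -/
abbrev dualPresheaf (X : A ⥤ V) [∀ a, HasRightDual (X.obj a)] : Aᵒᵖ ⥤ V where
  obj a := (X.obj a.unop)ᘁ
  map f := rightAdjointMate (X.map f.unop)
  map_id a := by simp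
  map_comp f g := by simp [comp_rightAdjointMate]

variable [HasColimitsOfSize.{w, w} V] (X Y : A ⥤ V) [∀ a, HasRightDual (X.obj a)]

/-- The dual `∫^a (X a)* ⊗ Y a` of `colim^Φ X`, where `Y` is the right dual of `Φ`. -/
abbrev wcolimDual : V := wcolim (dualPresheaf X) Y

/-- The coprojection `(X a)* ⊗ Y a ⟶ ∫^a (X a)* ⊗ Y a`. -/
def wcolimDualι (a : A) : (X.obj a)ᘁ ⊗ Y.obj a ⟶ wcolimDual X Y :=
  wcolimι (dualPresheaf X) Y a

lemma wcolimDualι_condition {a b : A} (f : a ⟶ b) :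
    rightAdjointMate (X.map f) ▷ Y.obj a ≫ wcolimDualι X Y a =
      ((X.obj b)ᘁ : V) ◁ Y.map f ≫ wcolimDualι X Y b :=
  wcolimι_condition (dualPresheaf X) Y f

/-- The transformation `Y a ⟶ X a ⊗ (X a)* ⊗ Y a ⟶ X a ⊗ ∫^b (X b)* ⊗ Y b`. -/
def toTensorDual : Y ⟶ X ⋙ tensorRight (wcolimDual X Y) where
  app a := (λ_ _).inv ≫ η_ (X.obj a) (X.obj a)ᘁ ▷ Y.obj a ≫ (α_ _ _ _).hom ≫
    X.obj a ◁ wcolimDualι X Y a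
  naturality a b f := by
    dsimp only [Functor.comp_obj, Functor.comp_map, Functor.flip_obj_obj, Functor.flip_obj_map,
      curriedTensor_obj_obj, curriedTensor_map_app]
    calc
      _ = (λ_ _).inv ≫ η_ (X.obj b) (X.obj b)ᘁ ▷ Y.obj a ≫ (α_ _ _ _).hom ≫
          X.obj b ◁ (((X.obj b)ᘁ : V) ◁ Y.map f ≫ wcolimDualι X Y b) := by
        rw [leftUnitor_inv_naturality_assoc, whisker_exchange_assoc,
          associator_naturality_right_assoc, MonoidalCategory.whiskerLeft_comp]
      _ = (λ_ _).inv ≫ (η_ (X.obj b) (X.obj b)ᘁ ≫ X.obj b ◁ rightAdjointMate (X.map f)) ▷ Y.obj a ≫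
          (α_ _ _ _).hom ≫ X.obj b ◁ wcolimDualι X Y a := by
        rw [← wcolimDualι_condition]; monoidal
      _ = _ := by
        rw [coevaluation_comp_rightAdjointMate, comp_whiskerRight_assoc,
          associator_naturality_left_assoc, ← whisker_exchange]
        simp only [Category.assoc]

lemma toTensorDual_comp_evaluation (a : A) :
    ((X.obj a)ᘁ : V) ◁ (toTensorDual X Y).app a ≫ (α_ _ _ _).inv ≫
      ε_ (X.obj a) (X.obj a)ᘁ ▷ wcolimDual X Y ≫ (λ_ _).hom = wcolimDualι X Y a := by
  calc
    _ = ((X.obj a)ᘁ : V) ◁ (λ_ _).inv ≫ (α_ _ _ _).inv ≫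
        (_ ◁ η_ (X.obj a) (X.obj a)ᘁ) ▷ Y.obj a ≫ (α_ _ _ _).inv ▷ Y.obj a ≫ (α_ _ _ _).hom ≫
          (((X.obj a)ᘁ ⊗ X.obj a) ◁ wcolimDualι X Y a ≫ ε_ (X.obj a) (X.obj a)ᘁ ▷ _) ≫
            (λ_ _).hom := by
      simp only [toTensorDual]; monoidal
    _ = ((X.obj a)ᘁ : V) ◁ (λ_ _).inv ≫ (α_ _ _ _).inv ≫
        (_ ◁ η_ (X.obj a) (X.obj a)ᘁ ≫ (α_ _ _ _).inv ≫ ε_ (X.obj a) (X.obj a)ᘁ ▷ _) ▷ Y.obj a ≫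
          (λ_ _).hom ▷ Y.obj a ≫ wcolimDualι X Y a := by
      rw [whisker_exchange]; monoidal
    _ = wcolimDualι X Y a := by
      rw [ExactPairing.coevaluation_evaluation]; monoidal

/-- The transformation `∫^a Φ a ⊗ Y a ⟶ (∫^a Φ a ⊗ X a) ⊗ ∫^b (X b)* ⊗ Y b` inserting the
coevaluations of the objects `X a`. -/
def wcolimCopairing (Φ : Aᵒᵖ ⥤ V) : wcolim Φ Y ⟶ wcolim Φ X ⊗ wcolimDual X Y :=
  wcolimMap Φ (toTensorDual X Y) ≫ wcolimTensorRight Φ X _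

lemma wcolimι_copairing (Φ : Aᵒᵖ ⥤ V) (a : A) :
    wcolimι Φ Y a ≫ wcolimCopairing X Y Φ =
      Φ.obj (op a) ◁ (toTensorDual X Y).app a ≫ (α_ _ _ _).inv ≫ wcolimι Φ X a ▷ _ := by
  rw [wcolimCopairing, reassoc_of% wcolimι_map, wcolimι_tensorRight]

variable [SymmetricCategory V] [MonoidalClosed V] {Y} {Φ : Aᵒᵖ ⥤ V}
  (ε : outerDiagram Y Φ ⟶ unitProf V A)

/-- The evaluation `(∫^b (X b)* ⊗ Y b) ⊗ colim^Φ X ⟶ 𝟙`, which on the summand at `b` is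
`(X b)* ⊗ Y b ⊗ colim^Φ X ⟶ (X b)* ⊗ X b ⟶ 𝟙`. -/
def wcolimPairing : wcolimDual X Y ⊗ wcolim Φ X ⟶ 𝟙_ V :=
  wcolimTensorDesc (dualPresheaf X) Y
    (fun b => (α_ _ _ _).hom ≫ ((X.obj b)ᘁ : V) ◁ wcolimEval ε X b ≫ ε_ (X.obj b) (X.obj b)ᘁ)
    fun a b f => by
      dsimp only [Quiver.Hom.unop_op]
      rw [associator_naturality_left_assoc, associator_naturality_middle_assoc,
        ← whisker_exchange_assoc, rightAdjointMate_comp_evaluation,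
        ← MonoidalCategory.whiskerLeft_comp_assoc, ← MonoidalCategory.whiskerLeft_comp_assoc,
        wcolimEval_comp_map]

lemma wcolimDualι_pairing (b : A) :
    wcolimDualι X Y b ▷ wcolim Φ X ≫ wcolimPairing X ε =
      (α_ _ _ _).hom ≫ ((X.obj b)ᘁ : V) ◁ wcolimEval ε X b ≫ ε_ (X.obj b) (X.obj b)ᘁ :=
  wcolimι_tensorDesc (dualPresheaf X) Y _ _ b

lemma toTensorDual_comp_pairing (b : A) :
    (toTensorDual X Y).app b ▷ wcolim Φ X ≫ (α_ _ _ _).hom ≫ X.obj b ◁ wcolimPairing X ε ≫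
      (ρ_ _).hom = wcolimEval ε X b := by
  calc
    _ = (λ_ _).inv ▷ wcolim Φ X ≫ η_ (X.obj b) (X.obj b)ᘁ ▷ Y.obj b ▷ wcolim Φ X ≫
        (α_ _ _ _).hom ▷ wcolim Φ X ≫ (α_ _ _ _).hom ≫
          X.obj b ◁ (wcolimDualι X Y b ▷ wcolim Φ X ≫ wcolimPairing X ε) ≫ (ρ_ _).hom := by
      simp only [toTensorDual]; monoidal
    _ = (λ_ _).inv ≫ η_ (X.obj b) (X.obj b)ᘁ ▷ (Y.obj b ⊗ wcolim Φ X) ≫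
        (_ ◁ wcolimEval ε X b) ≫ (α_ _ _ _).hom ≫
          X.obj b ◁ ε_ (X.obj b) (X.obj b)ᘁ ≫ (ρ_ _).hom := by
      rw [wcolimDualι_pairing]; monoidal
    _ = wcolimEval ε X b := by
      rw [← whisker_exchange_assoc, ← leftUnitor_inv_naturality_assoc,
        ExactPairing.evaluation_coevaluation_assoc, Iso.inv_hom_id, Category.comp_id,
        Iso.inv_hom_id, Category.comp_id]

lemma wcolimCopairing_comp_pairing (a : A) :
    wcolim Φ Y ◁ wcolimι Φ X a ≫ wcolimCopairing X Y Φ ▷ wcolim Φ X ≫ (α_ _ _ _).hom ≫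
      wcolim Φ X ◁ wcolimPairing X ε ≫ (ρ_ _).hom =
    (α_ _ _ _).inv ≫ contractLeft ε a ▷ X.obj a ≫ wcolimι Φ X a := by
  refine wcolimTensor_hom_ext fun b => ?_
  have eval_right : wcolimι Φ Y b ▷ wcolim Φ X ≫ wcolimCopairing X Y Φ ▷ wcolim Φ X ≫
      (α_ _ _ _).hom ≫ wcolim Φ X ◁ wcolimPairing X ε ≫ (ρ_ _).hom =
      (α_ _ _ _).hom ≫ Φ.obj (op b) ◁ wcolimEval ε X b ≫ wcolimι Φ X b := by
    rw [← comp_whiskerRight_assoc, wcolimι_copairing, ← toTensorDual_comp_pairing]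
    simp only [comp_whiskerRight, Category.assoc]
    rw [associator_naturality_left_assoc, ← whisker_exchange_assoc, rightUnitor_naturality]
    dsimp only [Functor.comp_obj, Functor.flip_obj_obj, curriedTensor_obj_obj]
    monoidal
  rw [← whisker_exchange_assoc, eval_right, associator_naturality_right_assoc,
    ← MonoidalCategory.whiskerLeft_comp_assoc, wcolimι_wcolimEval,
    associator_inv_naturality_left_assoc, ← comp_whiskerRight_assoc, wcolimι_contractLeft,
    comp_whiskerRight, comp_whiskerRight]
  simp only [Category.assoc]
  rw [presheafAct_wcolimι]
  monoidal

lemma pairing_comp_wcolimCopairing (a : A) :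
    wcolimDualι X Y a ▷ wcolim Φ Y ≫ wcolimDual X Y ◁ wcolimCopairing X Y Φ ≫
      (α_ _ _ _).inv ≫ wcolimPairing X ε ▷ _ ≫ (λ_ _).hom =
    (α_ _ _ _).hom ≫ ((X.obj a)ᘁ : V) ◁ contractRight ε a ≫ wcolimDualι X Y a := by
  have eval_toTensorDual : Y.obj a ◁ wcolimCopairing X Y Φ ≫ (α_ _ _ _).inv ≫
      wcolimEval ε X a ▷ wcolimDual X Y = contractRight ε a ≫ (toTensorDual X Y).app a := by
    rw [wcolimCopairing, MonoidalCategory.whiskerLeft_comp_assoc, ← wcolimEval_comp_tensorRight,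
      ← wcolimEval_comp_app]
    rfl
  calc
    _ = (α_ _ _ _).hom ≫ ((X.obj a)ᘁ : V) ◁ (Y.obj a ◁ wcolimCopairing X Y Φ ≫ (α_ _ _ _).inv ≫
          wcolimEval ε X a ▷ wcolimDual X Y) ≫ (α_ _ _ _).inv ≫
        ε_ (X.obj a) (X.obj a)ᘁ ▷ wcolimDual X Y ≫ (λ_ _).hom := by
      rw [← whisker_exchange_assoc, associator_inv_naturality_left_assoc,
        ← comp_whiskerRight_assoc, wcolimDualι_pairing]
      monoidal
    _ = _ := by
      rw [eval_toTensorDual, MonoidalCategory.whiskerLeft_comp_assoc, toTensorDual_comp_evaluation]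

/-- The duality between `colim^Φ X` and `∫^a (X a)* ⊗ Y a` for a right dual `Y` of `Φ`. -/
abbrev wcolimExactPairing (D : RightDual Φ) : ExactPairing (wcolim Φ X) (wcolimDual X D.dual) where
  coevaluation' := D.coev ≫ wcolimCopairing X D.dual Φ
  evaluation' := wcolimPairing X D.ev
  coevaluation_evaluation' := by
    rw [← cancel_mono (λ_ _).hom]
    refine wcolimTensor_hom_ext fun a => ?_
    change wcolimDualι X D.dual a ▷ _ ≫ _ = wcolimDualι X D.dual a ▷ _ ≫ _
    simp only [MonoidalCategory.whiskerLeft_comp, Category.assoc]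
    rw [← whisker_exchange_assoc, pairing_comp_wcolimCopairing, associator_naturality_right_assoc,
      ← MonoidalCategory.whiskerLeft_comp_assoc, D.triangle_right]
    monoidal
  evaluation_coevaluation' := by
    rw [← cancel_mono (ρ_ _).hom]
    refine tensorWcolim_hom_ext fun a => ?_
    simp only [comp_whiskerRight, Category.assoc]
    rw [whisker_exchange_assoc, wcolimCopairing_comp_pairing, associator_inv_naturality_left_assoc,
      ← comp_whiskerRight_assoc, D.triangle_left]
    monoidal

end Duality

section TraceFormula

variable {V : Type u} [Category.{v} V] [MonoidalCategory V] [SymmetricCategory V]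
  [MonoidalClosed V] [HasColimitsOfSize.{w, w} V] {A : Type w} [SmallCategory A]
  {Φ : Aᵒᵖ ⥤ V} (X : A ⥤ V) [∀ a, HasRightDual (X.obj a)]

lemma wcolimι_swap_ev_shadowTrace {Y : A ⥤ V} (ε : outerDiagram Y Φ ⟶ unitProf V A) (f : X ⟶ X)
    (a : A) :
    wcolimι Φ Y a ≫ coend.map (tensorDiagramSwap Φ Y) ≫ coend.map ε ≫ shadowTrace X f =
      (β_ _ _).hom ≫ partialTrace (evApp ε a a ▷ X.obj a ≫ functorAct X a a ≫ f.app a) := by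
  have act : coend.ι (unitProf V A) a ≫ shadowTrace X f =
      partialTrace (functorAct X a a ≫ f.app a) := by
    refine unitProf_hom_ext fun α => ?_
    rw [comp_partialTrace, reassoc_of% unitProfι_functorAct X α, partialTrace_leftUnitor_comp,
      ← shadowι_shadowTrace, shadowι, Category.assoc]
  rw [← comp_partialTrace, ← act]
  exact (coend.ι_map_assoc (tensorDiagramSwap Φ Y) a _).trans
    (congrArg ((β_ _ _).hom ≫ ·) (coend.ι_map_assoc ε a _))

lemma wcolimCopairing_comp_map_comp_pairing {Y : A ⥤ V}
    (ε : outerDiagram Y Φ ⟶ unitProf V A) (f : X ⟶ X) :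
    wcolimCopairing X Y Φ ≫ wcolimMap Φ f ▷ _ ≫ (β_ _ _).hom ≫ wcolimPairing X ε =
      coend.map (tensorDiagramSwap Φ Y) ≫ coend.map ε ≫ shadowTrace X f := by
  refine wcolim_hom_ext fun a => ?_
  have eval_map : (α_ _ _ _).hom ≫ Y.obj a ◁ (wcolimι Φ X a ≫ wcolimMap Φ f) ≫
      wcolimEval ε X a = evApp ε a a ▷ X.obj a ≫ functorAct X a a ≫ f.app a := by
    rw [MonoidalCategory.whiskerLeft_comp_assoc, ← wcolimEval_comp_app,
      reassoc_of% wcolimι_wcolimEval ε X a a, Iso.hom_inv_id_assoc]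
  have pairing_eq : (β_ _ _).hom ≫ (α_ _ _ _).hom ≫ ((X.obj a)ᘁ : V) ◁ (Y.obj a ◁
      (wcolimι Φ X a ≫ wcolimMap Φ f) ≫ wcolimEval ε X a) ≫ ε_ (X.obj a) (X.obj a)ᘁ =
      (Φ.obj (op a) ⊗ X.obj a) ◁ wcolimDualι X Y a ≫ (wcolimι Φ X a ≫ wcolimMap Φ f) ▷ _ ≫
        (β_ _ _).hom ≫ wcolimPairing X ε := by
    rw [MonoidalCategory.whiskerLeft_comp_assoc, ← associator_naturality_right_assoc,
      ← wcolimDualι_pairing, ← BraidedCategory.braiding_naturality_left_assoc,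
      ← BraidedCategory.braiding_naturality_right_assoc, whisker_exchange_assoc]
  rw [reassoc_of% wcolimι_copairing X Y Φ a, wcolimι_swap_ev_shadowTrace, ← eval_map,
    braiding_comp_partialTrace, pairing_eq]
  simp only [toTensorDual]
  monoidal

lemma trace_wcolimMap (D : RightDual Φ) [HasRightDual (wcolim Φ X)] (f : X ⟶ X) :
    trace (wcolimMap Φ f) = coeffVector D ≫ shadowTrace X f := by
  let := wcolimExactPairing X D
  calc
    _ = D.coev ≫ wcolimCopairing X D.dual Φ ≫ wcolimMap Φ f ▷ _ ≫ (β_ _ _).hom ≫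
        wcolimPairing X D.ev := by
      rw [trace_eq_of_exactPairing (wcolimDual X D.dual)]
      exact Category.assoc _ _ _
    _ = _ := by
      rw [wcolimCopairing_comp_map_comp_pairing, coeffVector, Category.assoc, Category.assoc]

end TraceFormula

section Semiadditive

variable {V : Type u} [Category.{v} V] [HasZeroMorphisms V] [HasFiniteBiproducts V]

lemma comp_sum {ι : Type*} (s : Finset ι) {P Q R : V} (g : P ⟶ Q) (f : ι → (Q ⟶ R)) :
    g ≫ ∑ i ∈ s, f i = ∑ i ∈ s, g ≫ f i :=
  map_sum (⟨⟨(g ≫ ·), comp_zero⟩, SemiadditiveOfBinaryBiproducts.comp_add g⟩ :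
    (Q ⟶ R) →+ (P ⟶ R)) f s

variable [MonoidalCategory V] [HasColimitsOfSize.{w, w} V] {A : Type w} [SmallCategory A]
  [Fintype (ConjClass A)]

lemma eq_sum_shadowProj_comp (rep : ConjClass A → Endo A)
    (hrep : ∀ c, ConjClass.mk (rep c).2 = c) {W : V} (T : shadow V A ⟶ W) :
    T = ∑ c : ConjClass A, shadowProj c ≫ shadowι (rep c).2 ≫ T := by
  classical
  refine shadow_hom_ext fun a α => ?_
  have hι : (shadowι (rep (ConjClass.mk α)).2 : 𝟙_ V ⟶ shadow V A) = shadowι α :=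
    shadowι_eq_of_mk_eq (y := ⟨a, α⟩) (hrep _)
  rw [comp_sum, Finset.sum_eq_single (ConjClass.mk α), reassoc_of% shadowι_proj, if_pos rfl,
    Category.id_comp, hι]
  · intro c _ hc
    rw [reassoc_of% shadowι_proj, if_neg hc.symm, zero_comp]
  · exact fun h => absurd (Finset.mem_univ _) h

end Semiadditive

end

end WeightedColim

theorem theorem1p1_general
    {V : Type u} [Category.{v} V] [MonoidalCategory V] [SymmetricCategory V] [MonoidalClosed V]
    [HasColimitsOfSize.{w, w} V] [HasZeroMorphisms V] [HasFiniteBiproducts V]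
    {A : Type w} [SmallCategory A] [Fintype (ConjClass A)]
    (Φ : Aᵒᵖ ⥤ V) (hΦ : IsAbsolute Φ)
    (X : A ⥤ V) (hX : ∀ a : A, Nonempty (HasRightDual (X.obj a))) :
    Nonempty (HasRightDual (wcolim Φ X)) ∧
    ∀ (D : RightDual Φ) [∀ a : A, HasRightDual (X.obj a)] [HasRightDual (wcolim Φ X)]
      (rep : ConjClass A → Endo A) (_ : ∀ c, ConjClass.mk (rep c).2 = c),
      trace (𝟙 (wcolim Φ X)) = ∑ c : ConjClass A, coeff D c ≫ trace (X.map (rep c).2) ∧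
      ∀ f : X ⟶ X, trace (wcolimMap Φ f) =
        ∑ c : ConjClass A, coeff D c ≫ trace (X.map (rep c).2 ≫ f.app (rep c).1) := by
  refine ⟨?_, fun D _ _ rep hrep => ?_⟩
  · obtain ⟨D⟩ := hΦ
    have (a : A) : HasRightDual (X.obj a) := (hX a).some
    have := wcolimExactPairing X D
    exact ⟨⟨wcolimDual X D.dual⟩⟩
  · have trace_map (f : X ⟶ X) : trace (wcolimMap Φ f) =
        ∑ c : ConjClass A, coeff D c ≫ trace (X.map (rep c).2 ≫ f.app (rep c).1) := by
      rw [trace_wcolimMap X D f, eq_sum_shadowProj_comp rep hrep (shadowTrace X f), comp_sum]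
      simp only [shadowι_shadowTrace, coeff, Category.assoc]
    refine ⟨?_, trace_map⟩
    simpa only [wcolimMap_id, NatTrans.id_app, Category.comp_id] using trace_map (𝟙 X)

theorem theorem1p1
    {V : Type u} [Category.{v} V] [MonoidalCategory V] [SymmetricCategory V] [MonoidalClosed V]
    [HasColimitsOfSize.{w, w} V] [HasZeroMorphisms V] [HasFiniteBiproducts V]
    {A : Type w} [SmallCategory A] [FinCategory A]
    (Φ : Aᵒᵖ ⥤ V) (hΦ : IsAbsolute Φ)
    (X : A ⥤ V) (hX : ∀ a : A, Nonempty (HasRightDual (X.obj a))) :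
    Nonempty (HasRightDual (wcolim Φ X)) ∧
    -- The formulas hold for every choice of the dual of `Φ`, of the duals of the objects `X a` and
    -- of the weighted colimit, and of a representative of each conjugacy class.
    ∀ (D : RightDual Φ) [∀ a : A, HasRightDual (X.obj a)] [HasRightDual (wcolim Φ X)]
      (rep : ConjClass A → Endo A) (_ : ∀ c, ConjClass.mk (rep c).2 = c),
      trace (𝟙 (wcolim Φ X)) = ∑ c : ConjClass A, coeff D c ≫ trace (X.map (rep c).2) ∧
      ∀ f : X ⟶ X, trace (wcolimMap Φ f) =
        ∑ c : ConjClass A, coeff D c ≫ trace (X.map (rep c).2 ≫ f.app (rep c).1) :=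
  theorem1p1_general Φ hΦ X hX
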